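/- All spaces are real and Hausdorff. Let $E=(E,\tau)$ be a locally convex space with topological dual $E'$. Definitions. Let $\mathbb S$ be the unit circle group and $\mathbb S_+=\{z\in\mathbb S:\operatorname{Re} z\ge 0\}$. For an abelian group $G$ with a group topology $t$, let $G^*$ be the group of all homomorphisms $G\to\mathbb S$ and $\widehat{(G,t)}\subseteq G^*$ (or $\widehat G$) the group of the continuous ones. A set $A\subseteq G$ is *quasi-convex* if for every $g\in G\setminus A$ there is $\chi\in\widehat G$ with $\chi(g)\notin\mathbb S_+$ and $\chi(A)\subseteq\mathbb S_+$; $t$ is *locally quasi-convex* if the quasi-convex neighborhoods of $0$ form a base at $0$. Two group topologies on $G$ are *compatible* if they have the same continuous characters. $(G,t)$ is a *Mackey group* if $t$ is locally quasi-convex and is finer than (or equal to) every locally quasi-convex group topology on $G$ compatible with $t$. A *Mackey group topology* on $(G,t)$ is a locally quasi-convex group topology $\mu$ on $G$ compatible with $t$ such that $(G,\mu)$ is a Mackey group. For $B\subseteq\widehat G$ put $B^{\triangleleft}=\{g\in G:\chi(g)\in\mathbb S_+\text{ for all }\chi\in B\}$, and for $A\subseteq G$ put $A^{\blacktriangleright}=\{\chi\in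 G^*:\chi(A)\subseteq\mathbb S_+\}$. Let $\mathrm{Mac}(G)$ be the family of all subsets $K\subseteq\widehat G$ that are compact and quasi-convex in the group $\widehat G$ with the topology $\sigma(\widehat G,G)$ of pointwise convergence and satisfy $\big(\underbrace{K+\dots+K}_{n}+F\big)^{\triangleleft\blacktriangleright}\subseteq\widehat G$ for every integer $n\ge1$ and every finite $F\subseteq\widehat G$ with $0\in F$. Let $\mathcal{CAC}(E')$ be the family of all $\sigma(E',E)$-compact absolutely convex subsets of $E'$, let $\psi:E'\to\widehat E$ be given by $\psi(\chi)(x)=e^{2\pi i\chi(x)}$, and let $\psi(\mathcal{CAC}(E'))=\{\psi(K):K\in\mathcal{CAC}(E')\}$. A family $\mathcal B$ of sets *swallows* a family $\mathcal A$ if every $A\in\mathcal A$ is contained in some $B\in\mathcal B$. The *Mackey space topology* of $E$ is the finest locally convex vector topology on $E$ having the same continuous linear functionals as $\tau$. Corollary. $E$ admits a Mackey group topology $\mu$ that is a vector topology if and only if $\psi(\mathcal{CAC}(E'))$ swallows $\mathrm{Mac}(E)$. In this case $\mu$ is the Mackey space topology of $E$. -/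

import Mathlib

open scoped Topology Pointwise

/-- A family `B` of subsets of a set swallows a family `A` if every member of `A` is contained in
some member of `B`. -/
def Swallows {Ω : Type*} (B A : Set (Set Ω)) : Prop :=
  ∀ a ∈ A, ∃ b ∈ B, a ⊆ b

/-- The closed right half `{z : 0 ≤ Re z}` of the unit circle. -/
def circlePlus : Set Circle := {z | 0 ≤ (z : ℂ).re}

section Groups

variable {G : Type*} [AddCommGroup G]

/-- The group of continuous characters of `(G, t)`, as a subgroup of the group `AddChar G Circle`
of all characters of `G`. -/
def charDual (t : TopologicalSpace G) : AddSubgroup (AddChar G Circle) where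
  carrier := {χ | Continuous[t, inferInstance] (fun g => χ g)}
  zero_mem' := by
    simpa using (continuous_const : Continuous[t, inferInstance] fun _ : G => (1 : Circle))
  add_mem' {χ η} hχ hη := by
    let _ := t
    have h : Continuous fun g => χ g * η g := Continuous.mul hχ hη
    simpa using h
  neg_mem' {χ} hχ := by
    let _ := t
    have h : Continuous fun g => (χ g)⁻¹ := Continuous.inv hχ
    simpa [AddChar.map_neg_eq_inv] using h

/-- The topology `σ(Ĝ, G)` of pointwise convergence on the group `Ĝ` of continuous characters. -/
@[reducible] noncomputable def weakStarTopology (t : TopologicalSpace G) : TopologicalSpace (charDual t) :=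
  TopologicalSpace.induced (fun (χ : charDual t) (g : G) => (χ : AddChar G Circle) g) inferInstance

/-- A subset `A` of `(G, t)` is quasi-convex if every `g ∉ A` can be separated from `A` by a
continuous character. -/
def IsQuasiConvex (t : TopologicalSpace G) (A : Set G) : Prop :=
  ∀ g, g ∉ A → ∃ χ ∈ charDual t, χ g ∉ circlePlus ∧ ∀ a ∈ A, χ a ∈ circlePlus

/-- `t` is a locally quasi-convex group topology on `G`: a group topology for which the
quasi-convex neighborhoods of zero form a base at zero. -/
def IsLQCGroupTopology (t : TopologicalSpace G) : Prop :=
  @IsTopologicalAddGroup G t _ ∧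
    ∀ U ∈ @nhds G t 0, ∃ V ∈ @nhds G t 0, IsQuasiConvex t V ∧ V ⊆ U

/-- The family of all locally quasi-convex group topologies on `G` compatible with `t`, that is,
with the same continuous characters as `t`. -/
def compatibleTopologies (t : TopologicalSpace G) : Set (TopologicalSpace G) :=
  {ν | IsLQCGroupTopology ν ∧ charDual ν = charDual t}

/-- `(G, t)` is a Mackey group: it is locally quasi-convex, and `t` is finer than every
locally quasi-convex group topology compatible with it. (In Mathlib's order on topologies
`t ≤ ν` means that `t` is finer than `ν`.) -/
def IsMackeyGroup (t : TopologicalSpace G) : Prop :=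
  IsLQCGroupTopology t ∧ ∀ ν ∈ compatibleTopologies t, t ≤ ν

/-- `μ` is a Mackey group topology on `(G, t)`. -/
def IsMackeyGroupTopology (t μ : TopologicalSpace G) : Prop :=
  μ ∈ compatibleTopologies t ∧ IsMackeyGroup μ

/-- The `n`-fold sum `A + ⋯ + A`. -/
def iterSum {H : Type*} [AddCommGroup H] (A : Set H) : ℕ → Set H
  | 0 => {0}
  | n + 1 => iterSum A n + A

/-- The inverse polar in `G` of a set `B` of continuous characters. -/
def inversePolar {t : TopologicalSpace G} (B : Set (charDual t)) : Set G :=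
  {g | ∀ χ ∈ B, (χ : AddChar G Circle) g ∈ circlePlus}

/-- The polar of `A ⊆ G` in the group of all, not necessarily continuous, characters. -/
def algebraicPolar (A : Set G) : Set (AddChar G Circle) :=
  {χ | ∀ g ∈ A, χ g ∈ circlePlus}

/-- The family `Mac(G)`: all quasi-convex compact subsets `K` of `(Ĝ, σ(Ĝ, G))` such that, for all
`n ≥ 1` and all finite `F ⊆ Ĝ` containing `0`, every character of `G` that belongs to the polar of
the inverse polar of `(n)K + F` is continuous. -/
def Mac (t : TopologicalSpace G) : Set (Set (charDual t)) :=
  {K | IsQuasiConvex (weakStarTopology t) K ∧ @IsCompact _ (weakStarTopology t) K ∧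
    ∀ n : ℕ, 1 ≤ n → ∀ F : Set (charDual t), F.Finite → 0 ∈ F →
      algebraicPolar (inversePolar (iterSum K n + F)) ⊆ (charDual t : Set (AddChar G Circle))}

end Groups

section Spaces

variable {E : Type*} [AddCommGroup E] [Module ℝ E]

/-- `t` is a vector topology on the real vector space `E`. -/
def IsVectorTopology (t : TopologicalSpace E) : Prop :=
  @IsTopologicalAddGroup E t _ ∧ @ContinuousSMul ℝ E _ _ t

/-- `ν` is a locally convex vector topology on `E` with the same continuous linear functionals
as `t`. -/
def IsCompatibleLocallyConvex (t ν : TopologicalSpace E) : Prop :=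
  IsVectorTopology ν ∧ @LocallyConvexSpace ℝ E _ _ _ _ ν ∧
    ∀ f : E →ₗ[ℝ] ℝ, Continuous[ν, inferInstance] f ↔ Continuous[t, inferInstance] f

/-- `μ` is the Mackey space topology associated with `t`: the finest locally convex vector
topology on `E` compatible with `t`. -/
def IsMackeySpaceTopology (t μ : TopologicalSpace E) : Prop :=
  IsCompatibleLocallyConvex t μ ∧ ∀ ν, IsCompatibleLocallyConvex t ν → μ ≤ ν

/-- The family of all `σ(E', E)`-compact absolutely convex subsets of `E'`; Mathlib's `WeakDual ℝ E`
is `E'` with the topology `σ(E', E)`. -/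
def CAC (E : Type*) [AddCommGroup E] [Module ℝ E] [TopologicalSpace E] :
    Set (Set (WeakDual ℝ E)) :=
  {K | IsCompact K ∧ AbsConvex ℝ K}

/-- The canonical map `ψ : E' → Ê`, `ψ(χ)(x) = exp(2πi χ(x))`. -/
noncomputable def psi [τ : TopologicalSpace E] (χ : WeakDual ℝ E) : charDual τ :=
  ⟨{ toFun := fun x => Circle.exp (2 * Real.pi * χ x)
     map_zero_eq_one' := by simp
     map_add_eq_mul' := fun x y => by rw [map_add, mul_add, Circle.exp_add] },
    Circle.exp.continuous.comp (continuous_const.mul χ.continuous)⟩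

end Spaces

/-! Both families describe equicontinuity. Up to inclusion, `Mac t` consists of the sets of
characters that are equicontinuous for some compatible locally quasi-convex group topology: polars
of neighborhoods of zero lie in it (`polar_mem_Mac`), and for `K` in it the sets `(nK + F)^◁` form a
base at zero of such a topology (`exists_compatible_inversePolar_mem_nhds`). On the linear side,
`CAC E` yields a compatible topology by Mackey–Arens
(`isCompatibleLocallyConvex_uniformCACTopology`), and polars of neighborhoods of a compatible vector
topology lie in `CAC E` by Alaoglu (`polar_mem_CAC`).

The two sides are linked by `psi_surjective` and by `abs_le_of_expChar_mem_circlePlus`: on a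
balanced set, values of `exp (2πi f)` in the right half circle force `|f| ≤ 1/4`. If the Mackey
group topology is a vector topology, `K^◁` contains a balanced neighborhood, whose real polar has a
`ψ`-image containing `K`. Conversely, swallowing makes uniform convergence on `CAC E` finer than
every compatible group topology.

Compatible locally convex topologies are compatible group topologies, and a compatible locally
quasi-convex vector topology is locally convex; so a Mackey group topology that is a vector topology
is the Mackey space topology. -/

/-! ### The right half circle -/

theorem one_mem_circlePlus : (1 : Circle) ∈ circlePlus := by
  simp [circlePlus]

theorem inv_mem_circlePlus {z : Circle} : z⁻¹ ∈ circlePlus ↔ z ∈ circlePlus := by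
  simp [circlePlus]

theorem isClosed_circlePlus : IsClosed circlePlus :=
  isClosed_le continuous_const (Complex.continuous_re.comp continuous_subtype_val)

theorem circlePlus_mem_nhds_one : circlePlus ∈ 𝓝 (1 : Circle) := by
  have h : Continuous fun z : Circle => (z : ℂ).re :=
    Complex.continuous_re.comp continuous_subtype_val
  have h1 : {z : Circle | 0 < (z : ℂ).re} ∈ 𝓝 (1 : Circle) :=
    (isOpen_lt continuous_const h).mem_nhds (by simp)
  exact Filter.mem_of_superset h1 fun z (hz : 0 < (z : ℂ).re) => hz.le

/-- If `z` and `z²` both lie in the right half, then `|Im z| ≤ Re z`, so the argument is at most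
`π/4`; two such arguments add up to at most `π/2`. -/
theorem mul_mem_circlePlus {z w : Circle} (hz : z ∈ circlePlus) (hz2 : z * z ∈ circlePlus)
    (hw : w ∈ circlePlus) (hw2 : w * w ∈ circlePlus) : z * w ∈ circlePlus := by
  simp only [circlePlus, Set.mem_ofPred_eq, Circle.coe_mul, Complex.mul_re] at *
  have h1 : |(z : ℂ).im| ≤ (z : ℂ).re := abs_le_of_sq_le_sq (by nlinarith) hz
  have h2 : |(w : ℂ).im| ≤ (w : ℂ).re := abs_le_of_sq_le_sq (by nlinarith) hw
  have h3 := mul_le_mul h1 h2 (abs_nonneg _) hz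
  rw [← abs_mul] at h3
  linarith [le_abs_self ((z : ℂ).im * (w : ℂ).im)]

/-- Since `z² - 1 = (z - 1)(z + 1)` and `|z + 1| ≥ √2 > 4/3`, halving contracts the distance to `1`
by a fixed factor. -/
theorem norm_sub_one_le_of_mem_circlePlus {z : Circle} (hz : z ∈ circlePlus) :
    ‖(z : ℂ) - 1‖ ≤ 3 / 4 * ‖((z * z : Circle) : ℂ) - 1‖ := by
  have hz' : 0 ≤ (z : ℂ).re := hz
  have hn : (z : ℂ).re * (z : ℂ).re + (z : ℂ).im * (z : ℂ).im = 1 := by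
    rw [← Complex.normSq_apply]; simp
  have h1 : (4 / 3 : ℝ) ≤ ‖(z : ℂ) + 1‖ := by
    refine (sq_le_sq₀ (by norm_num) (norm_nonneg _)).1 ?_
    rw [← Complex.normSq_eq_norm_sq, Complex.normSq_apply]
    simp
    nlinarith
  have h2 : ((z * z : Circle) : ℂ) - 1 = ((z : ℂ) - 1) * ((z : ℂ) + 1) := by
    rw [Circle.coe_mul]; ring
  rw [h2, norm_mul]
  nlinarith [norm_nonneg ((z : ℂ) - 1)]

/-! ### Continuity of characters and comparison of group topologies -/

section Groups

variable {G : Type*} [AddCommGroup G]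

theorem exists_nhds_add_self_mem [TopologicalSpace G] [IsTopologicalAddGroup G] {U : Set G}
    (hU : U ∈ 𝓝 (0 : G)) : ∃ V ∈ 𝓝 (0 : G), V ⊆ U ∧ ∀ x ∈ V, x + x ∈ U := by
  obtain ⟨V, hV, h⟩ := exists_nhds_zero_half hU
  exact ⟨V ∩ U, Filter.inter_mem hV hU, Set.inter_subset_right,
    fun x hx => h x hx.1 x hx.1⟩

/-- A character mapping a neighborhood of zero into the right half circle is continuous. -/
theorem mem_charDual_of_nhds [t : TopologicalSpace G] [IsTopologicalAddGroup G] {U : Set G}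
    (hU : U ∈ 𝓝 (0 : G)) {χ : AddChar G Circle} (hχ : χ ∈ algebraicPolar U) :
    χ ∈ charDual t := by
  -- Each halving of the neighborhood gains a factor `3/4`; the initial bound `2` is the diameter of
  -- the circle.
  have key : ∀ m : ℕ, ∃ V ∈ 𝓝 (0 : G), V ⊆ U ∧
      ∀ x ∈ V, ‖(χ x : ℂ) - 1‖ ≤ 2 * (3 / 4 : ℝ) ^ m := by
    intro m
    induction m with
    | zero =>
      refine ⟨U, hU, subset_rfl, fun x _ => ?_⟩
      calc ‖(χ x : ℂ) - 1‖ ≤ ‖(χ x : ℂ)‖ + ‖(1 : ℂ)‖ := norm_sub_le _ _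
        _ = 2 * (3 / 4 : ℝ) ^ 0 := by rw [Circle.norm_coe]; norm_num
    | succ m ih =>
      obtain ⟨V, hV, hVU, h⟩ := ih
      obtain ⟨W, hW, hWV, h'⟩ := exists_nhds_add_self_mem hV
      refine ⟨W, hW, hWV.trans hVU, fun x hx => ?_⟩
      have h1 := norm_sub_one_le_of_mem_circlePlus (hχ x (hVU (hWV hx)))
      rw [← AddChar.map_add_eq_mul] at h1
      have h2 := h _ (h' x hx)
      rw [pow_succ]
      linarith
  have h0 : ContinuousAt (fun g => χ g) 0 := by
    rw [Metric.continuousAt_iff']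
    intro ε hε
    obtain ⟨m, hm⟩ := exists_pow_lt_of_lt_one (half_pos hε) (by norm_num : (3 / 4 : ℝ) < 1)
    obtain ⟨V, hV, -, h⟩ := key m
    filter_upwards [hV] with x hx
    rw [AddChar.map_zero_eq_one]
    have := h x hx
    rw [show dist (χ x) 1 = dist (χ x : ℂ) ((1 : Circle) : ℂ) from rfl, dist_eq_norm,
      Circle.coe_one]
    linarith
  exact continuous_of_continuousAt_zero χ.toAddMonoidHom h0

theorem preimage_circlePlus_mem_nhds {t : TopologicalSpace G} {χ : AddChar G Circle}
    (hχ : χ ∈ charDual t) : {g | χ g ∈ circlePlus} ∈ @nhds G t 0 := by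
  let _ := t
  have h : Continuous fun g => χ g := hχ
  exact h.continuousAt.preimage_mem_nhds (by
    rw [AddChar.map_zero_eq_one]; exact circlePlus_mem_nhds_one)

theorem zero_mem_of_isQuasiConvex {t : TopologicalSpace G} {A : Set G}
    (hA : IsQuasiConvex t A) : 0 ∈ A := by
  by_contra h
  obtain ⟨χ, -, h1, -⟩ := hA 0 h
  exact h1 (by rw [AddChar.map_zero_eq_one]; exact one_mem_circlePlus)

/-- A topology is finer than another one if this holds for the neighborhoods of zero. -/
theorem le_of_nhds_zero_le {t ν : TopologicalSpace G} (ht : @IsTopologicalAddGroup G t _)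
    (hν : @IsTopologicalAddGroup G ν _) (h : @nhds G t 0 ≤ @nhds G ν 0) : t ≤ ν := by
  rw [← continuous_id_iff_le]
  exact @continuous_of_continuousAt_zero G t _ ht G _ _ ν
    (@IsTopologicalAddGroup.toContinuousAdd G ν _ hν) _ _ (AddMonoidHom.id G) h

/-! ### Inverse polars and the family `Mac` -/

section Polars

variable {t : TopologicalSpace G}

theorem inversePolar_anti {A B : Set (charDual t)} (h : A ⊆ B) :
    inversePolar B ⊆ inversePolar A :=
  fun _ hg χ hχ => hg χ (h hχ)

theorem zero_mem_inversePolar (B : Set (charDual t)) : 0 ∈ inversePolar B := fun χ _ => by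
  rw [AddChar.map_zero_eq_one]; exact one_mem_circlePlus

theorem neg_mem_inversePolar {B : Set (charDual t)} {g : G} (hg : g ∈ inversePolar B) :
    -g ∈ inversePolar B := fun χ hχ => by
  rw [AddChar.map_neg_eq_inv]; exact inv_mem_circlePlus.2 (hg χ hχ)

theorem add_mem_inversePolar {A B : Set (charDual t)} (hA : ∀ χ ∈ A, χ ∈ B)
    (hA2 : ∀ χ ∈ A, χ + χ ∈ B) {g h : G} (hg : g ∈ inversePolar B) (hh : h ∈ inversePolar B) :
    g + h ∈ inversePolar A := fun χ hχ => by
  rw [AddChar.map_add_eq_mul]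
  exact mul_mem_circlePlus (hg χ (hA χ hχ)) (by simpa using hg _ (hA2 χ hχ))
    (hh χ (hA χ hχ)) (by simpa using hh _ (hA2 χ hχ))

/-- After halving both neighborhoods, `x` and `x + x` lie in each inverse polar, as
`mul_mem_circlePlus` requires. -/
theorem inversePolar_add_mem_nhds {ν : TopologicalSpace G} (hν : @IsTopologicalAddGroup G ν _)
    {A B : Set (charDual t)} (hA : inversePolar A ∈ @nhds G ν 0)
    (hB : inversePolar B ∈ @nhds G ν 0) : inversePolar (A + B) ∈ @nhds G ν 0 := by
  let _ := ν
  obtain ⟨V, hV, hVA, hV2⟩ := exists_nhds_add_self_mem hA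
  obtain ⟨W, hW, hWB, hW2⟩ := exists_nhds_add_self_mem hB
  filter_upwards [hV, hW] with x hx hx'
  rintro _ ⟨χ, hχ, η, hη, rfl⟩
  have h1 := hV2 x hx χ hχ
  have h2 := hW2 x hx' η hη
  rw [AddChar.map_add_eq_mul] at h1 h2
  have := mul_mem_circlePlus (hVA hx χ hχ) h1 (hWB hx' η hη) h2
  simpa using this

theorem inversePolar_iterSum_mem_nhds {ν : TopologicalSpace G}
    (hν : @IsTopologicalAddGroup G ν _) {A : Set (charDual t)}
    (hA : inversePolar A ∈ @nhds G ν 0) (n : ℕ) :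
    inversePolar (iterSum A n) ∈ @nhds G ν 0 := by
  induction n with
  | zero =>
    refine Filter.mem_of_superset Filter.univ_mem fun x _ χ hχ => ?_
    obtain rfl : χ = 0 := hχ
    simpa using one_mem_circlePlus
  | succ n ih => exact inversePolar_add_mem_nhds hν ih hA

theorem inversePolar_mem_nhds_of_finite {ν : TopologicalSpace G} {F : Set (charDual t)}
    (hF : F.Finite) (h : charDual ν = charDual t) : inversePolar F ∈ @nhds G ν 0 := by
  let _ := ν
  have : inversePolar F = ⋂ χ ∈ F, {g | (χ : AddChar G Circle) g ∈ circlePlus} := by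
    ext; simp [inversePolar]
  rw [this, Filter.biInter_mem hF]
  exact fun χ _ => preimage_circlePlus_mem_nhds (by rw [h]; exact χ.2)

theorem iterSum_add {H : Type*} [AddCommGroup H] (A : Set H) (m n : ℕ) :
    iterSum A (m + n) = iterSum A m + iterSum A n := by
  induction n with
  | zero => simp [iterSum]
  | succ n ih => rw [← add_assoc, iterSum, ih, iterSum, add_assoc]

theorem zero_mem_iterSum {H : Type*} [AddCommGroup H] {A : Set H} (hA : 0 ∈ A) (n : ℕ) :
    0 ∈ iterSum A n := by
  induction n with
  | zero => rfl
  | succ n ih => exact ⟨0, ih, 0, hA, by simp⟩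

theorem iterSum_mono {H : Type*} [AddCommGroup H] {A : Set H} (hA : 0 ∈ A) {m n : ℕ}
    (h : m ≤ n) : iterSum A m ⊆ iterSum A n := by
  obtain ⟨k, rfl⟩ := Nat.exists_eq_add_of_le h
  rw [iterSum_add]
  exact Set.subset_add_left _ (zero_mem_iterSum hA k)

/-- The polar, among the continuous characters of `(G, t)`, of a quasi-convex neighborhood of zero
of a compatible topology belongs to `Mac t`. -/
theorem polar_mem_Mac {ν : TopologicalSpace G} (hν : @IsTopologicalAddGroup G ν _)
    (h : charDual ν = charDual t) {U : Set G} (hU : U ∈ @nhds G ν 0) :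
    {χ : charDual t | ∀ g ∈ U, (χ : AddChar G Circle) g ∈ circlePlus} ∈ Mac t := by
  set K := {χ : charDual t | ∀ g ∈ U, (χ : AddChar G Circle) g ∈ circlePlus} with hK
  have hcont : ∀ χ ∈ algebraicPolar U, χ ∈ charDual t := fun χ hχ =>
    h ▸ @mem_charDual_of_nhds G _ ν hν U hU χ hχ
  refine ⟨?_, ?_, ?_⟩
  · intro χ hχ
    simp only [hK, Set.mem_ofPred_eq, not_forall] at hχ
    obtain ⟨g, hg, hχg⟩ := hχ
    let ev : AddChar (charDual t) Circle :=
      { toFun := fun χ => (χ : AddChar G Circle) g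
        map_zero_eq_one' := by simp
        map_add_eq_mul' := by simp }
    refine ⟨ev, ?_, hχg, fun η hη => hη g hg⟩
    let _ := weakStarTopology t
    exact (continuous_apply g).comp continuous_induced_dom
  · let _ := weakStarTopology t
    have hind : Topology.IsInducing fun (χ : charDual t) (g : G) => (χ : AddChar G Circle) g := ⟨rfl⟩
    rw [hind.isCompact_iff]
    -- By Tychonoff the image in `G → Circle` only has to be closed. Continuity imposes no extra
    -- condition: every character in the polar of `U` is continuous by `hcont`.
    refine IsClosed.isCompact ?_
    have himg : (fun (χ : charDual t) (g : G) => (χ : AddChar G Circle) g) '' K =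
        {f : G → Circle | f 0 = 1} ∩ (⋂ x, ⋂ y, {f | f (x + y) = f x * f y}) ∩
          ⋂ g ∈ U, {f | f g ∈ circlePlus} := by
      ext f
      simp only [Set.mem_image, Set.mem_inter_iff, Set.mem_ofPred_eq, Set.mem_iInter]
      constructor
      · rintro ⟨χ, hχ, rfl⟩
        exact ⟨⟨AddChar.map_zero_eq_one _, AddChar.map_add_eq_mul _⟩, hχ⟩
      · rintro ⟨⟨h0, hadd⟩, hf⟩
        exact ⟨⟨⟨f, h0, hadd⟩, hcont _ hf⟩, hf, rfl⟩
    rw [himg]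
    refine ((isClosed_eq (continuous_apply _) continuous_const).inter ?_).inter ?_
    · exact isClosed_iInter fun x => isClosed_iInter fun y =>
        isClosed_eq (continuous_apply _) (.mul (f := fun f : G → Circle => f x) (continuous_apply _) (continuous_apply y))
    · exact isClosed_biInter fun g _ => isClosed_circlePlus.preimage (continuous_apply g)
  · intro n _ F hF _ χ hχ
    have hKU : inversePolar K ∈ @nhds G ν 0 :=
      Filter.mem_of_superset hU fun g hg η hη => hη g hg
    have := inversePolar_add_mem_nhds hν (inversePolar_iterSum_mem_nhds hν hKU n)
      (inversePolar_mem_nhds_of_finite hF h)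
    exact h ▸ @mem_charDual_of_nhds G _ ν hν _ this χ hχ

/-- Every `K ∈ Mac t` is equicontinuous for some compatible locally quasi-convex topology. -/
theorem exists_compatible_inversePolar_mem_nhds {K : Set (charDual t)} (hK : K ∈ Mac t) :
    ∃ ν ∈ compatibleTopologies t, inversePolar K ∈ @nhds G ν 0 := by
  have hK0 : 0 ∈ K := @zero_mem_of_isQuasiConvex _ _ (weakStarTopology t) _ hK.1
  -- The multiples `nK` make addition continuous, and the finite sets `F` keep every character of
  -- `charDual t` continuous.
  let S : Set (Set G) := {W | ∃ n : ℕ, 1 ≤ n ∧ ∃ F : Set (charDual t), F.Finite ∧ 0 ∈ F ∧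
    W = inversePolar (iterSum K n + F)}
  let B : AddGroupFilterBasis G := addGroupFilterBasisOfComm S
    ⟨_, 1, le_rfl, {0}, Set.finite_singleton _, rfl, rfl⟩
    (by
      rintro _ _ ⟨n, hn, F, hF, hF0, rfl⟩ ⟨m, hm, F', hF', -, rfl⟩
      refine ⟨_, ⟨max n m, le_max_of_le_left hn, F ∪ F', hF.union hF', Or.inl hF0, rfl⟩, ?_⟩
      exact Set.subset_inter
        (inversePolar_anti (Set.add_subset_add (iterSum_mono hK0 (le_max_left n m))
          Set.subset_union_left))
        (inversePolar_anti (Set.add_subset_add (iterSum_mono hK0 (le_max_right n m))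
          Set.subset_union_right)))
    (by
      rintro _ ⟨n, hn, F, hF, hF0, rfl⟩
      exact zero_mem_inversePolar _)
    (by
      rintro _ ⟨n, hn, F, hF, hF0, rfl⟩
      -- Doubling both `n` and `F` puts `χ + χ` into the larger sum for each `χ` in the smaller one.
      refine ⟨_, ⟨n + n, by omega, F + F, hF.add hF, ⟨0, hF0, 0, hF0, by simp⟩, rfl⟩, ?_⟩
      rintro _ ⟨g, hg, h, hh, rfl⟩
      refine add_mem_inversePolar ?_ ?_ hg hh
      · exact fun χ hχ => Set.add_subset_add (iterSum_mono hK0 (by omega))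
          (Set.subset_add_left _ hF0) hχ
      · intro χ hχ
        rw [iterSum_add, add_add_add_comm]
        exact Set.add_mem_add hχ hχ)
    (by
      rintro _ ⟨n, hn, F, hF, hF0, rfl⟩
      exact ⟨_, ⟨n, hn, F, hF, hF0, rfl⟩, fun g hg => neg_mem_inversePolar hg⟩)
  let ν := B.topology
  have hν : @IsTopologicalAddGroup G ν _ := B.isTopologicalAddGroup
  have hbasis : (@nhds G ν 0).HasBasis (fun V => V ∈ B) id := B.nhds_zero_hasBasis
  have hmem : ∀ (F : Set (charDual t)), F.Finite → 0 ∈ F →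
      inversePolar (K + F) ∈ @nhds G ν 0 := fun F hF hF0 =>
    hbasis.mem_of_mem (i := inversePolar (K + F))
      ⟨1, le_rfl, F, hF, hF0, by simp [iterSum]⟩
  have hdual : charDual ν = charDual t := by
    ext χ
    constructor
    · intro hχ
      obtain ⟨_, ⟨n, hn, F, hF, hF0, rfl⟩, hsub⟩ :=
        hbasis.mem_iff.1 (preimage_circlePlus_mem_nhds hχ)
      -- The last condition in `Mac` says exactly that this topology acquires no new continuous
      -- characters.
      exact hK.2.2 n hn F hF hF0 fun g hg => hsub hg
    · intro hχ
      refine @mem_charDual_of_nhds G _ ν hν _ (hmem {0, ⟨χ, hχ⟩} (by simp) (by simp)) χ ?_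
      intro g hg
      exact hg ⟨χ, hχ⟩ ⟨0, hK0, _, by simp, zero_add _⟩
  refine ⟨ν, ⟨⟨hν, fun U hU => ?_⟩, hdual⟩, ?_⟩
  · obtain ⟨V, hV, hVU⟩ := hbasis.mem_iff.1 hU
    refine ⟨V, hbasis.mem_of_mem hV, ?_, hVU⟩
    obtain ⟨n, hn, F, hF, hF0, rfl⟩ := hV
    intro g hg
    simp only [inversePolar, Set.mem_ofPred_eq, not_forall] at hg
    obtain ⟨χ, hχ, hχg⟩ := hg
    exact ⟨χ, by rw [hdual]; exact χ.2, hχg, fun a ha => ha χ hχ⟩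
  · refine Filter.mem_of_superset (hmem {0} (by simp) rfl) (inversePolar_anti ?_)
    exact Set.subset_add_left _ rfl

end Polars

end Groups

/-! ### Characters and linear functionals on real vector spaces -/

section Spaces

theorem exp_mem_circlePlus {y : ℝ} (hy : |y| ≤ 1 / 4) :
    Circle.exp (2 * Real.pi * y) ∈ circlePlus := by
  have h := abs_le.1 hy
  simp only [circlePlus, Set.mem_ofPred_eq, Circle.coe_exp, Complex.exp_ofReal_mul_I_re]
  exact Real.cos_nonneg_of_neg_pi_div_two_le_of_le (by nlinarith [Real.pi_pos])
    (by nlinarith [Real.pi_pos])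

theorem exp_notMem_circlePlus {y : ℝ} (h1 : 1 / 4 < y) (h2 : y ≤ 1 / 2) :
    Circle.exp (2 * Real.pi * y) ∉ circlePlus := by
  simp only [circlePlus, Set.mem_ofPred_eq, Circle.coe_exp, Complex.exp_ofReal_mul_I_re, not_le]
  exact Real.cos_neg_of_pi_div_two_lt_of_lt (by nlinarith [Real.pi_pos])
    (by nlinarith [Real.pi_pos])

/-- If the characters `exp (2 π i t y)` with `|t| ≤ 1` take values in the right half circle, then
`|y| ≤ 1 / 4`. -/
theorem abs_le_of_forall_exp_mem_circlePlus {y : ℝ}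
    (h : ∀ t : ℝ, |t| ≤ 1 → Circle.exp (2 * Real.pi * (t * y)) ∈ circlePlus) :
    |y| ≤ 1 / 4 := by
  by_contra! hy
  have hy0 : y ≠ 0 := by rintro rfl; norm_num at hy
  -- Scaling `y` down to absolute value at most `1/2` avoids wrapping around the circle.
  refine exp_notMem_circlePlus (y := min |y| (1 / 2)) (lt_min hy (by norm_num))
    (min_le_right _ _) ?_
  have h1 := h (min |y| (1 / 2) / y) (by
    rw [abs_div, div_le_one (abs_pos.2 hy0), abs_of_nonneg (le_min (abs_nonneg _) (by norm_num))]
    exact min_le_left _ _)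
  rwa [div_mul_cancel₀ _ hy0] at h1

variable {E : Type*} [AddCommGroup E] [Module ℝ E]

/-- The character `exp (2 π i f)` of a linear functional `f`. -/
noncomputable def expChar (f : E →ₗ[ℝ] ℝ) : AddChar E Circle where
  toFun x := Circle.exp (2 * Real.pi * f x)
  map_zero_eq_one' := by simp
  map_add_eq_mul' x y := by rw [map_add, mul_add, Circle.exp_add]

theorem expChar_apply (f : E →ₗ[ℝ] ℝ) (x : E) :
    expChar f x = Circle.exp (2 * Real.pi * f x) := rfl

theorem expChar_mem_charDual {t : TopologicalSpace E} {f : E →ₗ[ℝ] ℝ}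
    (hf : Continuous[t, inferInstance] f) : expChar f ∈ charDual t := by
  let _ := t
  exact Circle.exp.continuous.comp (continuous_const.mul hf)

theorem psi_apply [τ : TopologicalSpace E] (χ : WeakDual ℝ E) (x : E) :
    (psi χ : AddChar E Circle) x = Circle.exp (2 * Real.pi * χ x) := rfl

/-- Continuous characters of a locally convex space lift to continuous linear functionals. -/
theorem psi_surjective [τ : TopologicalSpace E] [IsTopologicalAddGroup E] [ContinuousSMul ℝ E]
    [LocallyConvexSpace ℝ E] : Function.Surjective (psi (E := E)) := by
  rintro ⟨χ, hχ⟩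
  have hχ' : Continuous fun g => χ g := hχ
  -- `E` is simply connected and locally path connected, so `χ` lifts through the covering `ℝ → 𝕊`.
  obtain ⟨F, ⟨hF0, hF⟩, -⟩ := Circle.isCoveringMap_exp.existsUnique_continuousMap_lifts
    ⟨fun g => χ g, hχ'⟩ 0 0 (by simp)
  have hF' : ∀ x, Circle.exp (F x) = χ x := fun x => congr_fun hF x
  -- Both sides lift the same map on `E × E` and agree at `0`, so uniqueness of lifts gives
  -- additivity.
  have hadd : (fun p : E × E => F (p.1 + p.2)) = fun p => F p.1 + F p.2 := by
    refine Circle.isCoveringMap_exp.eq_of_comp_eq (by fun_prop) (by fun_prop) ?_ 0 (by simp [hF0])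
    funext p
    simp only [Function.comp_apply, Circle.exp_add, hF', AddChar.map_add_eq_mul]
  let f : E →L[ℝ] ℝ := AddMonoidHom.toRealLinearMap
    { toFun := F, map_zero' := hF0, map_add' := fun x y => congr_fun hadd (x, y) } F.continuous
  refine ⟨StrongDual.toWeakDual ((2 * Real.pi)⁻¹ • f), ?_⟩
  ext x : 2
  rw [psi_apply, ← hF' x]
  congr 1
  change 2 * Real.pi * ((2 * Real.pi)⁻¹ * F x) = F x
  rw [mul_inv_cancel_left₀ (by positivity)]

theorem mem_charDual_iff_exists [τ : TopologicalSpace E] [IsTopologicalAddGroup E]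
    [ContinuousSMul ℝ E] [LocallyConvexSpace ℝ E] {χ : AddChar E Circle} :
    χ ∈ charDual τ ↔ ∃ f : E →ₗ[ℝ] ℝ, Continuous f ∧ expChar f = χ := by
  constructor
  · intro h
    obtain ⟨φ, hφ⟩ := psi_surjective ⟨χ, h⟩
    exact ⟨(WeakDual.toStrongDual φ : E →ₗ[ℝ] ℝ), (WeakDual.toStrongDual φ).continuous,
      congr_arg Subtype.val hφ⟩
  · rintro ⟨f, hf, rfl⟩
    exact expChar_mem_charDual hf

theorem continuous_of_abs_le_on_nhds [TopologicalSpace E] [IsTopologicalAddGroup E]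
    [ContinuousSMul ℝ E] {f : E →ₗ[ℝ] ℝ} {c : ℝ} {V : Set E} (hV : V ∈ 𝓝 (0 : E))
    (h : ∀ x ∈ V, |f x| ≤ c) : Continuous f := by
  have h1 : Continuous f.toSeminorm := Seminorm.continuous' (r := c)
    (Filter.mem_of_superset hV fun x hx => by simpa using h x hx)
  refine continuous_of_continuousAt_zero f ?_
  rw [ContinuousAt, map_zero, tendsto_zero_iff_norm_tendsto_zero]
  have h2 := h1.tendsto 0
  rwa [map_zero] at h2

/-- The whole segment from `-x` to `x` stays in `V`, so `f x` cannot leave `[-1/4, 1/4]` and return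
to the right half circle after a full turn. -/
theorem abs_le_of_expChar_mem_circlePlus {V : Set E} (hV : Balanced ℝ V) {f : E →ₗ[ℝ] ℝ}
    (h : ∀ x ∈ V, expChar f x ∈ circlePlus) {x : E} (hx : x ∈ V) : |f x| ≤ 1 / 4 := by
  refine abs_le_of_forall_exp_mem_circlePlus fun t ht => ?_
  have := h (t • x) (hV t ht (Set.smul_mem_smul_set hx))
  rwa [expChar_apply, map_smul, smul_eq_mul] at this

/-- Balanced neighborhoods suffice, so local convexity is not needed. This matters for a Mackey
group topology known only to be a vector topology. -/
theorem expChar_mem_charDual_iff [τ : TopologicalSpace E] [IsTopologicalAddGroup E]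
    [ContinuousSMul ℝ E] {f : E →ₗ[ℝ] ℝ} :
    expChar f ∈ charDual τ ↔ Continuous f := by
  refine ⟨fun h => ?_, expChar_mem_charDual⟩
  obtain ⟨V, ⟨hV, hVb⟩, hVs⟩ :=
    (nhds_basis_balanced ℝ E).mem_iff.1 (preimage_circlePlus_mem_nhds h)
  exact continuous_of_abs_le_on_nhds hV fun x hx => abs_le_of_expChar_mem_circlePlus hVb hVs hx

theorem isLQCGroupTopology_of_locallyConvex [ν : TopologicalSpace E] [IsTopologicalAddGroup E]
    [ContinuousSMul ℝ E] [LocallyConvexSpace ℝ E] : IsLQCGroupTopology ν := by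
  refine ⟨inferInstance, fun U hU => ?_⟩
  obtain ⟨C, ⟨hC, hCc⟩, hCU⟩ := (closed_nhds_basis 0).mem_iff.1 hU
  obtain ⟨D, ⟨hD, hDc⟩, hDC⟩ := (nhds_hasBasis_absConvex ℝ E).mem_iff.1 hC
  refine ⟨closure D, Filter.mem_of_superset hD subset_closure, ?_,
    (closure_minimal hDC hCc).trans hCU⟩
  intro g hg
  have hcl : AbsConvex ℝ (closure D) := hDc.closure
  obtain ⟨f, s, hs, hsg⟩ := geometric_hahn_banach_closed_point hcl.2 isClosed_closure hg
  have hs0 : 0 < s := by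
    have := hs 0 (subset_closure (mem_of_mem_nhds hD))
    rwa [map_zero] at this
  have hfg : 0 < f g := hs0.trans hsg
  -- The first term sends `closure D` into `[-1/4, 1/4]`. As `f g > s`, the minimum also places `c *
  -- f g` in `(1/4, 1/2]`, outside the right half circle.
  set c : ℝ := min (1 / 4 / s) (1 / 2 / f g) with hc
  have hc0 : 0 < c := by positivity
  refine ⟨expChar (c • (f : E →ₗ[ℝ] ℝ)),
    expChar_mem_charDual (f.continuous.const_smul c), ?_, ?_⟩
  · refine exp_notMem_circlePlus (y := c * f g) ?_ ?_
    · rw [hc, min_mul_of_nonneg _ _ hfg.le, div_mul_cancel₀ _ hfg.ne', div_mul_eq_mul_div]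
      refine lt_min ?_ (by norm_num)
      rw [lt_div_iff₀ hs0]
      linarith
    · calc c * f g ≤ 1 / 2 / f g * f g := by gcongr; exact min_le_right _ _
        _ = 1 / 2 := div_mul_cancel₀ _ hfg.ne'
  · intro a ha
    refine exp_mem_circlePlus (y := c * f a) ?_
    have h1 : |f a| ≤ s := by
      refine abs_le.2 ⟨?_, (hs a ha).le⟩
      have := hs (-a) (hcl.1.neg_mem_iff.2 ha)
      rw [map_neg] at this
      linarith
    rw [abs_mul, abs_of_pos hc0]
    calc c * |f a| ≤ 1 / 4 / s * s := by gcongr; exact min_le_left _ _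
      _ = 1 / 4 := div_mul_cancel₀ _ hs0.ne'

theorem IsCompatibleLocallyConvex.mem_compatibleTopologies {ν : TopologicalSpace E}
    [τ : TopologicalSpace E] [IsTopologicalAddGroup E] [ContinuousSMul ℝ E]
    [LocallyConvexSpace ℝ E] (hν : IsCompatibleLocallyConvex τ ν) : ν ∈ compatibleTopologies τ := by
  obtain ⟨⟨h1, h2⟩, h3, h4⟩ := hν
  refine ⟨@isLQCGroupTopology_of_locallyConvex E _ _ ν h1 h2 h3, ?_⟩
  ext χ
  refine (@mem_charDual_iff_exists E _ _ ν h1 h2 h3 χ).trans ?_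
  simp only [h4, mem_charDual_iff_exists]

theorem continuous_iff_of_charDual_eq {τ μ : TopologicalSpace E} (hτ : IsVectorTopology τ)
    (hμ : IsVectorTopology μ) (h : charDual μ = charDual τ)
    (f : E →ₗ[ℝ] ℝ) : Continuous[μ, inferInstance] f ↔ Continuous[τ, inferInstance] f := by
  rw [← @expChar_mem_charDual_iff E _ _ μ hμ.1 hμ.2, h,
    @expChar_mem_charDual_iff E _ _ τ hτ.1 hτ.2]

/-- A locally quasi-convex vector topology compatible with a locally convex topology is locally
convex. -/
theorem locallyConvexSpace_of_mem_compatibleTopologies {μ : TopologicalSpace E}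
    [τ : TopologicalSpace E] [IsTopologicalAddGroup E] [ContinuousSMul ℝ E]
    [LocallyConvexSpace ℝ E] (hμ : μ ∈ compatibleTopologies τ) (hv : IsVectorTopology μ) :
    @LocallyConvexSpace ℝ E _ _ _ _ μ := by
  have hchar : ∀ χ ∈ charDual μ, ∃ f : E →ₗ[ℝ] ℝ, expChar f = χ := fun χ hχ => by
    obtain ⟨f, -, hf⟩ := mem_charDual_iff_exists.1 (hμ.2 ▸ hχ)
    exact ⟨f, hf⟩
  obtain ⟨⟨-, hlqc⟩, -⟩ := hμ
  let _ := μ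
  have _ := hv.1
  have _ := hv.2
  rw [locallyConvexSpace_iff_exists_convex_subset_zero]
  intro U hU
  obtain ⟨V, hV, hVq, hVU⟩ := hlqc U hU
  obtain ⟨W, ⟨hW, hWb⟩, hWV⟩ := (nhds_basis_balanced ℝ E).mem_iff.1 hV
  -- This is the bipolar of `W`. It lies in `V` because every character separating a point from `V`
  -- is `expChar f` with `|f| ≤ 1/4` on `W`.
  refine ⟨⋂ f ∈ {f : E →ₗ[ℝ] ℝ | ∀ x ∈ W, |f x| ≤ 1 / 4}, {x | |f x| ≤ 1 / 4},
    Filter.mem_of_superset hW ?_, ?_, ?_⟩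
  · exact fun x hx => Set.mem_iInter₂.2 fun f hf => hf x hx
  · refine convex_iInter₂ fun f _ => ?_
    have : {x | |f x| ≤ 1 / 4} = f ⁻¹' Set.Icc (-(1 / 4)) (1 / 4) := by
      ext x; simp [abs_le]
    rw [this]
    exact (convex_Icc _ _).linear_preimage f
  · refine subset_trans (fun x hx => ?_) hVU
    by_contra hxV
    obtain ⟨χ, hχ, hχx, hχV⟩ := hVq x hxV
    obtain ⟨f, rfl⟩ := hchar χ hχ
    exact hχx (exp_mem_circlePlus (Set.mem_iInter₂.1 hx f fun y hy =>
      abs_le_of_expChar_mem_circlePlus hWb (fun z hz => hχV z (hWV hz)) hy))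

/-- Alaoglu's theorem for a neighborhood of zero of a vector topology with the same continuous
linear functionals. -/
theorem polar_mem_CAC {μ : TopologicalSpace E} [τ : TopologicalSpace E]
    (hv : IsVectorTopology μ)
    (h : ∀ f : E →ₗ[ℝ] ℝ, Continuous[μ, inferInstance] f → Continuous[τ, inferInstance] f)
    {V : Set E} (hV : V ∈ @nhds E μ 0) :
    {χ : WeakDual ℝ E | ∀ x ∈ V, |χ x| ≤ 1 / 4} ∈ CAC E := by
  have hcont : ∀ f : E →ₗ[ℝ] ℝ, (∀ x ∈ V, |f x| ≤ 1 / 4) → Continuous[τ, inferInstance] f :=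
    fun f hf => h f (@continuous_of_abs_le_on_nhds E _ _ μ hv.1 hv.2 f _ V hV hf)
  -- `V` is absorbing, which bounds each coordinate `χ x` over the polar and puts it in a product of
  -- compact intervals.
  have habs : ∀ x : E, ∃ a : ℝ, a ≠ 0 ∧ a • x ∈ V := fun x => by
    let _ := μ
    have _ := hv.1
    have _ := hv.2
    have h1 : Filter.Tendsto (fun a : ℝ => a • x) (𝓝[≠] 0) (𝓝 (0 : E)) :=
      tendsto_nhdsWithin_of_tendsto_nhds
        (Continuous.tendsto' (by fun_prop) _ _ (zero_smul ℝ x))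
    obtain ⟨a, ha, ha0⟩ := ((h1.eventually hV).and self_mem_nhdsWithin).exists
    exact ⟨a, ha0, ha⟩
  choose a ha0 haV using habs
  set L := {χ : WeakDual ℝ E | ∀ x ∈ V, |χ x| ≤ 1 / 4}
  refine ⟨?_, ?_, ?_⟩
  · have hind : Topology.IsInducing fun (χ : WeakDual ℝ E) (x : E) => χ x := ⟨rfl⟩
    rw [hind.isCompact_iff]
    refine (isCompact_univ_pi fun x => isCompact_Icc (a := -(1 / 4 / |a x|))
      (b := 1 / 4 / |a x|)).of_isClosed_subset ?_ ?_
    -- Linearity and the bounds on `V` are closed conditions, and by `hcont` they already imply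
    -- continuity.
    · have himg : (fun (χ : WeakDual ℝ E) (x : E) => χ x) '' L =
          (⋂ x, ⋂ y, {f : E → ℝ | f (x + y) = f x + f y}) ∩
            (⋂ c : ℝ, ⋂ x, {f | f (c • x) = c * f x}) ∩ ⋂ x ∈ V, {f | |f x| ≤ 1 / 4} := by
        ext f
        simp only [Set.mem_image, Set.mem_inter_iff, Set.mem_ofPred_eq, Set.mem_iInter]
        constructor
        · rintro ⟨χ, hχ, rfl⟩
          exact ⟨⟨fun x y => map_add χ x y, fun c x => by simp⟩, hχ⟩
        · rintro ⟨⟨h1, h2⟩, h3⟩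
          let g : E →ₗ[ℝ] ℝ := { toFun := f, map_add' := h1, map_smul' := h2 }
          exact ⟨StrongDual.toWeakDual ⟨g, hcont g h3⟩, h3, rfl⟩
      rw [himg]
      refine ((isClosed_iInter fun x => isClosed_iInter fun y => ?_).inter
        (isClosed_iInter fun c => isClosed_iInter fun x => ?_)).inter
        (isClosed_biInter fun x _ => ?_)
      · exact isClosed_eq (by fun_prop) (by fun_prop)
      · exact isClosed_eq (by fun_prop) (by fun_prop)
      · exact isClosed_le (by fun_prop) (by fun_prop)
    · rintro _ ⟨χ, hχ, rfl⟩ x -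
      have h1 := hχ _ (haV x)
      rw [map_smul, smul_eq_mul, abs_mul] at h1
      refine abs_le.1 ?_
      rw [le_div_iff₀ (abs_pos.2 (ha0 x))]
      linarith
  · rintro c hc _ ⟨χ, hχ, rfl⟩ x hx
    have h1 : |c * χ x| ≤ 1 / 4 := by
      rw [abs_mul]
      exact (mul_le_of_le_one_left (abs_nonneg _) hc).trans (hχ x hx)
    exact h1
  · intro χ hχ η hη a b ha hb hab x hx
    have h1 : |a * χ x + b * η x| ≤ 1 / 4 := by
      calc |a * χ x + b * η x| ≤ |a * χ x| + |b * η x| := abs_add_le _ _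
        _ = a * |χ x| + b * |η x| := by rw [abs_mul, abs_mul, abs_of_nonneg ha, abs_of_nonneg hb]
        _ ≤ a * (1 / 4) + b * (1 / 4) := by gcongr <;> [exact hχ x hx; exact hη x hx]
        _ = 1 / 4 := by rw [← add_mul, hab, one_mul]
    exact h1

end Spaces

/-! ### Uniform convergence on `CAC E` and the Mackey–Arens theorem -/

section MackeySpaceTopology

variable {E : Type*} [AddCommGroup E] [Module ℝ E]

theorem bddAbove_range_abs_of_mem_CAC [TopologicalSpace E] {L : Set (WeakDual ℝ E)}
    (hL : L ∈ CAC E) (x : E) : BddAbove (Set.range fun χ : L => |(χ : WeakDual ℝ E) x|) := by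
  have := (hL.1.image (WeakDual.eval_continuous (𝕜 := ℝ) x).abs).bddAbove
  rwa [Set.image_eq_range] at this

/-- The supremum seminorm of a `σ(E', E)`-compact absolutely convex set of functionals. -/
noncomputable def supSeminorm [TopologicalSpace E] (L : Set (WeakDual ℝ E)) (hL : L ∈ CAC E) :
    Seminorm ℝ E :=
  Seminorm.ofSMulLE (fun x => ⨆ χ : L, |(χ : WeakDual ℝ E) x|)
    (by simp)
    (fun x y => Real.iSup_le (fun χ => by
      rw [map_add]
      exact (abs_add_le _ _).trans (add_le_add (le_ciSup (bddAbove_range_abs_of_mem_CAC hL x) χ)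
        (le_ciSup (bddAbove_range_abs_of_mem_CAC hL y) χ)))
      (add_nonneg (Real.iSup_nonneg fun _ => abs_nonneg _)
        (Real.iSup_nonneg fun _ => abs_nonneg _)))
    (fun r x => Real.iSup_le (fun χ => by
      rw [map_smul, smul_eq_mul, abs_mul, Real.norm_eq_abs]
      gcongr
      exact le_ciSup (bddAbove_range_abs_of_mem_CAC hL x) χ)
      (mul_nonneg (norm_nonneg _) (Real.iSup_nonneg fun _ => abs_nonneg _)))

theorem abs_le_supSeminorm [TopologicalSpace E] {L : Set (WeakDual ℝ E)} (hL : L ∈ CAC E)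
    {χ : WeakDual ℝ E} (hχ : χ ∈ L) (x : E) : |χ x| ≤ supSeminorm L hL x :=
  le_ciSup (bddAbove_range_abs_of_mem_CAC hL x) ⟨χ, hχ⟩

theorem supSeminorm_le [TopologicalSpace E] {L : Set (WeakDual ℝ E)} (hL : L ∈ CAC E)
    {x : E} {r : ℝ} (hr : 0 ≤ r) (h : ∀ χ ∈ L, |χ x| ≤ r) : supSeminorm L hL x ≤ r :=
  Real.iSup_le (fun χ => h χ χ.2) hr

/-- A linear functional dominated by the supremum seminorm of `L` belongs to `L`. -/
theorem continuous_of_abs_le_supSeminorm [TopologicalSpace E] {L : Set (WeakDual ℝ E)}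
    (hL : L ∈ CAC E) (h0 : 0 ∈ L) {f : E →ₗ[ℝ] ℝ} (hf : ∀ x, |f x| ≤ supSeminorm L hL x) :
    Continuous f := by
  -- Pass to the algebraic dual with the weak topology induced by `E`: the image of `L` is compact,
  -- hence closed there, and continuous functionals are evaluations at points of `E`. Hahn–Banach
  -- then separates `f` from `L` by some `x`.
  let B : (E →ₗ[ℝ] ℝ) →ₗ[ℝ] E →ₗ[ℝ] ℝ := LinearMap.id
  let j : WeakDual ℝ E →ₗ[ℝ] WeakBilin B :=
    { toFun := fun χ => (WeakDual.toStrongDual χ : E →ₗ[ℝ] ℝ)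
      map_add' := fun _ _ => rfl
      map_smul' := fun _ _ => rfl }
  have hj : Continuous j := WeakBilin.continuous_of_continuous_eval B fun x =>
    WeakDual.eval_continuous x
  have hB : Function.Injective B := Function.injective_id
  have : T2Space (WeakBilin B) := (WeakBilin.isEmbedding hB).t2Space
  by_cases hfL : (f : WeakBilin B) ∈ j '' L
  · obtain ⟨χ, -, rfl⟩ := hfL
    exact (WeakDual.toStrongDual χ).continuous
  exfalso
  obtain ⟨u, s, hus, hsu⟩ := geometric_hahn_banach_closed_point
    (hL.2.2.linear_image j) (hL.1.image hj).isClosed hfL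
  obtain ⟨x, rfl⟩ := LinearMap.dualEmbedding_surjective B u
  have hχ : ∀ χ ∈ L, χ x < s := fun χ hχ => hus _ ⟨χ, hχ, rfl⟩
  have hfx : s < f x := hsu
  have hs0 : 0 < s := hχ 0 h0
  have : supSeminorm L hL x ≤ s := supSeminorm_le hL hs0.le fun χ h => by
    refine abs_le.2 ⟨?_, (hχ χ h).le⟩
    have h1 : -χ x < s := hχ (-χ) (hL.2.1.neg_mem_iff.2 h)
    linarith
  linarith [hf x, le_abs_self (f x)]

theorem singleton_zero_mem_CAC [TopologicalSpace E] : {0} ∈ CAC E :=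
  ⟨isCompact_singleton, balanced_zero, convex_singleton 0⟩

theorem add_mem_CAC [TopologicalSpace E] {K L : Set (WeakDual ℝ E)} (hK : K ∈ CAC E)
    (hL : L ∈ CAC E) : K + L ∈ CAC E :=
  ⟨hK.1.add hL.1, hK.2.1.add hL.2.1, hK.2.2.add hL.2.2⟩

theorem smul_mem_CAC [TopologicalSpace E] {L : Set (WeakDual ℝ E)} (hL : L ∈ CAC E) (c : ℝ) :
    c • L ∈ CAC E :=
  ⟨hL.1.smul c, hL.2.1.smul c, hL.2.2.smul c⟩

theorem supSeminorm_mono [TopologicalSpace E] {K L : Set (WeakDual ℝ E)} (hK : K ∈ CAC E)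
    (hL : L ∈ CAC E) (h : K ⊆ L) : supSeminorm K hK ≤ supSeminorm L hL := fun x =>
  supSeminorm_le hK (apply_nonneg _ _) fun _ hχ => abs_le_supSeminorm hL (h hχ) x

/-- The seminorms of uniform convergence on the `σ(E', E)`-compact absolutely convex sets. -/
noncomputable def mackeySeminorms (E : Type*) [AddCommGroup E] [Module ℝ E] [TopologicalSpace E] :
    SeminormFamily ℝ E {L : Set (WeakDual ℝ E) // L ∈ CAC E ∧ 0 ∈ L} :=
  fun L => supSeminorm L.1 L.2.1

instance [TopologicalSpace E] : Nonempty {L : Set (WeakDual ℝ E) // L ∈ CAC E ∧ 0 ∈ L} :=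
  ⟨⟨{0}, singleton_zero_mem_CAC, rfl⟩⟩

/-- The family is directed: as `0` lies in every index set, `K + L` contains both `K` and `L`. -/
theorem exists_finset_sup_mackeySeminorms_le [TopologicalSpace E]
    (s : Finset {L : Set (WeakDual ℝ E) // L ∈ CAC E ∧ 0 ∈ L}) :
    ∃ L, s.sup (mackeySeminorms E) ≤ mackeySeminorms E L := by
  classical
  induction s using Finset.induction_on with
  | empty => exact ⟨⟨{0}, singleton_zero_mem_CAC, rfl⟩, bot_le⟩
  | insert K s _ ih =>
    obtain ⟨L, hL⟩ := ih
    refine ⟨⟨K.1 + L.1, add_mem_CAC K.2.1 L.2.1, ⟨0, K.2.2, 0, L.2.2, by simp⟩⟩, ?_⟩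
    rw [Finset.sup_insert]
    exact sup_le (supSeminorm_mono _ _ (Set.subset_add_left _ L.2.2))
      (hL.trans (supSeminorm_mono _ _ (Set.subset_add_right _ K.2.2)))

/-- The topology of uniform convergence on the `σ(E', E)`-compact absolutely convex sets. -/
@[reducible] noncomputable def uniformCACTopology (E : Type*) [AddCommGroup E] [Module ℝ E]
    [TopologicalSpace E] : TopologicalSpace E :=
  (mackeySeminorms E).moduleFilterBasis.topology

section WithSeminorms

variable {ι : Type*} {p : SeminormFamily ℝ E ι} [t : TopologicalSpace E]

theorem isVectorTopology_of_withSeminorms (h : WithSeminorms p) : IsVectorTopology t :=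
  ⟨h.topologicalAddGroup, h.continuousSMul⟩

theorem locallyConvexSpace_of_withSeminorms (h : WithSeminorms p) : LocallyConvexSpace ℝ E :=
  h.toLocallyConvexSpace

theorem setOf_lt_mem_nhds_of_withSeminorms (h : WithSeminorms p) (i : ι) {r : ℝ} (hr : 0 < r) :
    {x | p i x < r} ∈ 𝓝 (0 : E) := by
  refine Filter.mem_of_superset (h.hasBasis_zero_ball.mem_of_mem (i := ({i}, r)) hr) fun x hx => ?_
  simpa [Seminorm.mem_ball_zero] using hx

theorem exists_abs_le_finset_sup_of_withSeminorms (h : WithSeminorms p) {f : E →ₗ[ℝ] ℝ}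
    (hf : Continuous f) : ∃ (s : Finset ι) (C : NNReal), ∀ x, |f x| ≤ C * s.sup p x := by
  obtain ⟨s, C, -, hC⟩ := Seminorm.bound_of_continuous h f.toSeminorm hf.norm
  exact ⟨s, C, fun x => hC x⟩

end WithSeminorms

theorem withSeminorms_uniformCACTopology [τ : TopologicalSpace E] :
    @WithSeminorms ℝ E _ _ _ _ (mackeySeminorms E) (uniformCACTopology E) :=
  @WithSeminorms.mk ℝ E _ _ _ _ (mackeySeminorms E) (uniformCACTopology E) rfl

theorem setOf_supSeminorm_lt_mem_nhds [τ : TopologicalSpace E] {L : Set (WeakDual ℝ E)}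
    (hL : L ∈ CAC E) (h0 : 0 ∈ L) {r : ℝ} (hr : 0 < r) :
    {x | supSeminorm L hL x < r} ∈ @nhds E (uniformCACTopology E) 0 :=
  setOf_lt_mem_nhds_of_withSeminorms (t := uniformCACTopology E)
    withSeminorms_uniformCACTopology ⟨L, hL, h0⟩ hr

/-- The Mackey–Arens theorem: the topology of uniform convergence on the `σ(E', E)`-compact
absolutely convex sets is compatible with the original topology. -/
theorem isCompatibleLocallyConvex_uniformCACTopology [τ : TopologicalSpace E] :
    IsCompatibleLocallyConvex τ (uniformCACTopology E) := by
  have hws := withSeminorms_uniformCACTopology (E := E)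
  have hv : IsVectorTopology (uniformCACTopology E) :=
    isVectorTopology_of_withSeminorms (t := uniformCACTopology E) hws
  refine ⟨hv, locallyConvexSpace_of_withSeminorms (t := uniformCACTopology E) hws,
    fun f => ⟨fun hf => ?_, fun hf => ?_⟩⟩
  · obtain ⟨s, C, hC⟩ :=
      exists_abs_le_finset_sup_of_withSeminorms (t := uniformCACTopology E) hws hf
    obtain ⟨L, hL⟩ := exists_finset_sup_mackeySeminorms_le s
    -- The constant `C` is absorbed into the set, since `C • L` is again in `CAC E`.
    refine continuous_of_abs_le_supSeminorm (smul_mem_CAC L.2.1 (C : ℝ))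
      ⟨0, L.2.2, smul_zero _⟩ fun x => ?_
    have h1 : |f x| ≤ C * mackeySeminorms E L x :=
      (hC x).trans (mul_le_mul_of_nonneg_left (hL x) C.2)
    refine h1.trans ?_
    rw [show mackeySeminorms E L x = ⨆ χ : L.1, |(χ : WeakDual ℝ E) x| from rfl,
      Real.mul_iSup_of_nonneg C.coe_nonneg]
    refine Real.iSup_le (fun χ => ?_) (apply_nonneg _ _)
    have h2 := abs_le_supSeminorm (smul_mem_CAC L.2.1 (C : ℝ))
      (Set.smul_mem_smul_set (a := (C : ℝ)) χ.2) x
    have h3 : |(C : ℝ) * (χ : WeakDual ℝ E) x| ≤ _ := h2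
    rwa [abs_mul, abs_of_nonneg C.coe_nonneg] at h3
  · let φ : WeakDual ℝ E := StrongDual.toWeakDual ⟨f, hf⟩
    -- The segment from `-φ` to `φ` is compact and absolutely convex, and its supremum seminorm
    -- dominates `|f|`.
    have hL : {χ : WeakDual ℝ E | ∃ c : ℝ, |c| ≤ 1 ∧ c • φ = χ} ∈ CAC E := by
      have himg : {χ : WeakDual ℝ E | ∃ c : ℝ, |c| ≤ 1 ∧ c • φ = χ} =
          (LinearMap.toSpanSingleton ℝ (WeakDual ℝ E) φ) '' Set.Icc (-1) 1 := by
        ext χ; simp [abs_le]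
      refine ⟨?_, ?_, ?_⟩
      · rw [himg]
        exact isCompact_Icc.image (continuous_id.smul continuous_const)
      · rintro a ha _ ⟨_, ⟨c, hc, rfl⟩, rfl⟩
        exact ⟨a * c, by rw [abs_mul]; exact mul_le_one₀ ha (abs_nonneg _) hc, mul_smul _ _ _⟩
      · rw [himg]
        exact (convex_Icc _ _).linear_image _
    refine @continuous_of_abs_le_on_nhds E _ _ (uniformCACTopology E) hv.1 hv.2 f 1 _
      (setOf_supSeminorm_lt_mem_nhds hL ⟨0, by simp, zero_smul _ _⟩ one_pos) fun x hx => ?_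
    exact (abs_le_supSeminorm hL ⟨1, by simp, one_smul _ _⟩ x).trans (le_of_lt hx)

end MackeySpaceTopology

/-! ### Mackey group topologies and swallowing -/

section Corollary

theorem isMackeyGroupTopology_iff {G : Type*} [AddCommGroup G] {t μ : TopologicalSpace G} :
    IsMackeyGroupTopology t μ ↔
      μ ∈ compatibleTopologies t ∧ ∀ ν ∈ compatibleTopologies t, μ ≤ ν := by
  constructor
  · rintro ⟨h, -, h'⟩
    exact ⟨h, fun ν hν => h' ν ⟨hν.1, hν.2.trans h.2.symm⟩⟩
  · rintro ⟨h, h'⟩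
    exact ⟨h, h.1, fun ν hν => h' ν ⟨hν.1, hν.2.trans h.2⟩⟩

variable {E : Type*} [AddCommGroup E] [Module ℝ E]

/-- A quasi-convex neighborhood is recovered from its polar. If that polar lies in `ψ(L)`, the
neighborhood contains every `x` at which all functionals of `L` are at most `1/4` in absolute value.
-/
theorem mem_nhds_uniformCACTopology_of_swallows {ν : TopologicalSpace E} [τ : TopologicalSpace E]
    (h : Swallows ((fun K : Set (WeakDual ℝ E) => psi '' K) '' CAC E) (Mac τ))
    (hν : ν ∈ compatibleTopologies τ) {U : Set E} (hU : U ∈ @nhds E ν 0) :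
    U ∈ @nhds E (uniformCACTopology E) 0 := by
  obtain ⟨V, hV, hVq, hVU⟩ := hν.1.2 U hU
  obtain ⟨_, ⟨L, hL, rfl⟩, hKL⟩ := h _ (polar_mem_Mac hν.1.1 hν.2 hV)
  -- The trivial character is in the polar, so `L` is nonempty; being balanced, it contains `0`.
  have h0 : 0 ∈ L := by
    refine hL.2.1.zero_mem ?_
    obtain ⟨χ, hχ, -⟩ := hKL (show (0 : charDual τ) ∈ _ from fun g _ => by
      simpa using one_mem_circlePlus)
    exact ⟨χ, hχ⟩
  refine Filter.mem_of_superset (setOf_supSeminorm_lt_mem_nhds hL h0 (r := 1 / 4) (by norm_num))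
    (subset_trans (fun x hx => ?_) hVU)
  by_contra hxV
  obtain ⟨χ, hχ, hχx, hχV⟩ := hVq x hxV
  rw [hν.2] at hχ
  obtain ⟨φ, hφ, hφχ⟩ := hKL (show (⟨χ, hχ⟩ : charDual τ) ∈ _ from hχV)
  obtain rfl : (psi φ : AddChar E Circle) = χ := congr_arg Subtype.val hφχ
  exact hχx (exp_mem_circlePlus ((abs_le_supSeminorm hL hφ x).trans (le_of_lt hx)))

/-- If `ψ(CAC(E'))` swallows `Mac(E)`, then uniform convergence on the members of `CAC(E')` is a
Mackey group topology. -/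
theorem isMackeyGroupTopology_uniformCACTopology [τ : TopologicalSpace E]
    [IsTopologicalAddGroup E] [ContinuousSMul ℝ E] [LocallyConvexSpace ℝ E]
    (h : Swallows ((fun K : Set (WeakDual ℝ E) => psi '' K) '' CAC E) (Mac τ)) :
    IsMackeyGroupTopology τ (uniformCACTopology E) := by
  have hc := isCompatibleLocallyConvex_uniformCACTopology (E := E)
  rw [isMackeyGroupTopology_iff]
  exact ⟨hc.mem_compatibleTopologies, fun ν hν => le_of_nhds_zero_le hc.1.1 hν.1.1 fun _ hU =>
    mem_nhds_uniformCACTopology_of_swallows (τ := τ) h hν hU⟩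

/-- If a Mackey group topology of `E` is a vector topology, then `ψ(CAC(E'))` swallows `Mac(E)`. -/
theorem swallows_of_isMackeyGroupTopology {μ : TopologicalSpace E} [τ : TopologicalSpace E]
    [IsTopologicalAddGroup E] [ContinuousSMul ℝ E] [LocallyConvexSpace ℝ E]
    (hμ : IsMackeyGroupTopology τ μ) (hv : IsVectorTopology μ) :
    Swallows ((fun K : Set (WeakDual ℝ E) => psi '' K) '' CAC E) (Mac τ) := by
  intro K hK
  rw [isMackeyGroupTopology_iff] at hμ
  -- `K^◁` is a neighborhood for some compatible topology, and `μ` is finer than that one.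
  have hKμ : inversePolar K ∈ @nhds E μ 0 := by
    obtain ⟨ν, hν, hKν⟩ := exists_compatible_inversePolar_mem_nhds hK
    exact nhds_mono (hμ.2 ν hν) hKν
  obtain ⟨V, ⟨hV, hVb⟩, hVK⟩ :=
    (@nhds_basis_balanced ℝ E _ _ _ μ hv.2 _).mem_iff.1 hKμ
  refine ⟨_, ⟨_, polar_mem_CAC hv
    (fun f => (continuous_iff_of_charDual_eq ⟨inferInstance, inferInstance⟩ hv hμ.1.2 f).1) hV,
    rfl⟩, fun χ hχ => ?_⟩
  obtain ⟨φ, rfl⟩ := psi_surjective χ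
  exact ⟨φ, fun x hx => abs_le_of_expChar_mem_circlePlus hVb
    (f := (WeakDual.toStrongDual φ : E →ₗ[ℝ] ℝ)) (fun y hy => hVK hy _ hχ) hx, rfl⟩

end Corollary

theorem corollaryc (E : Type*) [AddCommGroup E] [Module ℝ E] [τ : TopologicalSpace E]
    [IsTopologicalAddGroup E] [ContinuousSMul ℝ E] [LocallyConvexSpace ℝ E] [T2Space E] :
    ((∃ μ : TopologicalSpace E, IsMackeyGroupTopology τ μ ∧ IsVectorTopology μ) ↔
      Swallows ((fun K : Set (WeakDual ℝ E) => psi '' K) '' CAC E) (Mac τ)) ∧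
    ∀ μ : TopologicalSpace E, IsMackeyGroupTopology τ μ → IsVectorTopology μ →
      IsMackeySpaceTopology τ μ := by
  refine ⟨⟨?_, fun h => ?_⟩, fun μ hμ hv => ?_⟩
  · rintro ⟨μ, hμ, hv⟩
    exact swallows_of_isMackeyGroupTopology (τ := τ) hμ hv
  · exact ⟨uniformCACTopology E, isMackeyGroupTopology_uniformCACTopology h,
      isCompatibleLocallyConvex_uniformCACTopology.1⟩
  · rw [isMackeyGroupTopology_iff] at hμ
    exact ⟨⟨hv, locallyConvexSpace_of_mem_compatibleTopologies (τ := τ) hμ.1 hv,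
      continuous_iff_of_charDual_eq ⟨inferInstance, inferInstance⟩ hv hμ.1.2⟩,
      fun ν hν => hμ.2 ν (hν.mem_compatibleTopologies (τ := τ))⟩
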